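/- There is a universal constant $C>0$ such that the following holds. Let $N\ge 1$ and $n=N^2$, and identify $\mathbb C^n$ with the space of $N\times N$ images $x=(x_{j,i})_{0\le j,i<N}$, where $(j,i)$ is the $i$-th pixel of the $j$-th horizontal line. Let $A_0=\phi\otimes\phi\in\mathbb C^{n\times n}$ be the unitary 2D discrete Fourier transform, where $\phi_{k,j}=N^{-1/2}e^{-2\pi \mathrm i kj/N}$ for $0\le k,j<N$. For $0\le k<N$ let $B_k\in\mathbb C^{N\times n}$ be the block of the $N$ rows of $A_0$ on the $k$-th horizontal line of the Fourier plane, that is $(B_k x)_{k'}=\sum_{j,i}\phi_{k,j}\,\phi_{k',i}\,x_{j,i}$. Let $J\subset\{0,\dots,N-1\}$ with $|J|=q$, let $S\subset\{(j,i): j\in J,\ 0\le i<N\}$ with $|S|=s\ge 2$, let $x\in\mathbb C^n$ be supported on $S$ (that is, $x$ vanishes outside $S$), and let $\varepsilon\in(0,1)$. Let $K_1,\dots,K_m$ be independent random variables, uniformly distributed on the $N$ horizontal lines, i.e. $\mathbb P(K_\ell=k)=\pi^\star_k=1/\sqrt n=1/N$, and let $$A=\frac1{\sqrt m}\left(\frac{1}{\sqrt{\pi^\star_{K_\ell}}}\,B_{K_\ell}\right)_{1\le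 \ell\le m}.$$ If $$ m\ \ge\ C\cdot q\cdot\ln(s)\,\ln\left(\frac n\varepsilon\right),$$ then, with probability at least $1-\varepsilon$, $x$ is the unique solution of $$\min_{z\in\mathbb C^n,\ Az=Ax}\|z\|_1 .$$ -/

import Mathlib

open MeasureTheory ProbabilityTheory

noncomputable section

/-- The unitary one-dimensional discrete Fourier matrix of size `N`, with entries
`N^(-1/2) * exp (-2 π i k j / N)` for `0 ≤ k, j < N`. -/
def fourier1D (N : ℕ) : Matrix (Fin N) (Fin N) ℂ :=
  Matrix.of fun k j =>
    ((1 / Real.sqrt N : ℝ) : ℂ) *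
      Complex.exp (-2 * Real.pi * Complex.I * ((k : ℕ) : ℂ) * ((j : ℕ) : ℂ) / (N : ℂ))

/-- The unitary 2D discrete Fourier transform of `N × N` images, `A₀ = φ ⊗ φ`. The pair
`(j, i)` is the pixel number `i` on the horizontal line number `j`; likewise for frequencies. -/
def fourier2D (N : ℕ) : Matrix (Fin N × Fin N) (Fin N × Fin N) ℂ :=
  Matrix.kroneckerMap (fun a b => a * b) (fourier1D N) (fourier1D N)

/-- The block `B_k`: the rows of the 2D Fourier matrix on the `k`-th horizontal line of the
Fourier plane. These blocks partition the rows of `fourier2D N`. -/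
def horizontalLineBlock (N : ℕ) (k : Fin N) : Matrix (Fin N) (Fin N × Fin N) ℂ :=
  (fourier2D N).submatrix (fun i => (k, i)) id

/-- The sensing matrix `A = m^(-1/2) (π_{K_ℓ}^(-1/2) B_{K_ℓ})_{ℓ}` obtained by stacking the blocks
number `K 0, …, K (m - 1)` of a dictionary `B`, with drawing probabilities `p`. -/
def sensingMatrix {κ ρ ι : Type*} (B : κ → Matrix ρ ι ℂ) (p : κ → ℝ) {m : ℕ} (K : Fin m → κ) :
    Matrix (Fin m × ρ) ι ℂ :=
  Matrix.of fun r j =>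
    ((1 / Real.sqrt m * (1 / Real.sqrt (p (K r.1))) : ℝ) : ℂ) * B (K r.1) r.2 j

/-- The `ℓ¹` norm of a complex vector. -/
def l1Norm {ι : Type*} [Fintype ι] (x : ι → ℂ) : ℝ := ∑ i, ‖x i‖

/-- `x` is the unique solution of the problem: minimize `‖z‖₁` subject to `A z = y`. -/
def IsUniqueL1Minimizer {ρ ι : Type*} [Fintype ι] (A : Matrix ρ ι ℂ) (y : ρ → ℂ)
    (x : ι → ℂ) : Prop :=
  A.mulVec x = y ∧ ∀ z : ι → ℂ, A.mulVec z = y → z ≠ x → l1Norm x < l1Norm z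

/-- The uniform drawing probabilities on the `N` horizontal lines. -/
def uniformLines (N : ℕ) : Fin N → ℝ := fun _ => 1 / (N : ℝ)

end

/-! ### Orthogonality of the Fourier matrix -/

/-! The transform along a line is unitary, so knowing `B_k x` amounts to knowing the `k`-th vertical
Fourier coefficient of every column. The operators `N • (B_k)ᴴ B_k` average to the identity over
`k`. On images supported on `J × [N]`, every column has at most `q` nonzero entries; this is why
`q`, and not `s`, governs both the size and the variance of the entries.

A scalar Bernstein bound, with a union over pixels, shows that a batch of about `q · log (N ^ 2 /
ε)` lines reproduces a fixed image up to a quarter of its sup norm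
(`card_not_forall_norm_sampleGram_sub_le`). Golfing iterates this on the residual with fresh
batches: `L ≈ log s` rounds yield a dual certificate with error `4 ^ (-L)` on `S` and size at most
`1 / 3` off `S` (`card_not_exists_certificate_le`).

No operator norm estimate on `S` is needed. Certificates are built not only for the sign of `x` but
for each of the `s` basis vectors of `S`; the latter control the entries on `S` of a kernel vector
by its mass off `S` (`l1Norm_lt_of_certificates`). The `s + 1` targets only cost a factor in the
union bound. -/

lemma star_fourier1D_mul (N : ℕ) (k t j : Fin N) :
    star (fourier1D N k t) * fourier1D N k j =
      (1 / (N : ℂ)) *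
        Complex.exp (2 * Real.pi * Complex.I * (((t : ℕ) : ℂ) - ((j : ℕ) : ℂ)) / N) ^ (k : ℕ) := by
  have hN : ((1 / Real.sqrt N : ℝ) : ℂ) * ((1 / Real.sqrt N : ℝ) : ℂ) = 1 / (N : ℂ) := by
    rw [← Complex.ofReal_mul, div_mul_div_comm, Real.mul_self_sqrt (Nat.cast_nonneg N)]
    push_cast
    ring
  simp only [fourier1D, Matrix.of_apply, Complex.star_def, map_mul, Complex.conj_ofReal,
    ← Complex.exp_conj, map_div₀, map_neg, Complex.conj_I, Complex.conj_natCast, map_ofNat]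
  rw [mul_mul_mul_comm, hN, ← Complex.exp_add, ← Complex.exp_nat_mul]
  congr 2
  ring

lemma sum_star_fourier1D_mul (N : ℕ) (t j : Fin N) :
    ∑ k, star (fourier1D N k t) * fourier1D N k j = if t = j then 1 else 0 := by
  have hN0 : N ≠ 0 := fun h => (h ▸ t).elim0
  have hN : (N : ℂ) ≠ 0 := Nat.cast_ne_zero.2 hN0
  simp only [star_fourier1D_mul, ← Finset.mul_sum]
  set ζ := Complex.exp (2 * Real.pi * Complex.I * (((t : ℕ) : ℂ) - ((j : ℕ) : ℂ)) / N) with hζ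
  rw [Fin.sum_univ_eq_sum_range (fun k => ζ ^ k)]
  split_ifs with h
  · subst h
    have : ζ = 1 := by simp [hζ]
    simp [this, hN]
  · have h1 : ζ ≠ 1 := by
      intro h1
      obtain ⟨n, hn⟩ := Complex.exp_eq_one_iff.1 h1
      have hpi : (2 * Real.pi * Complex.I : ℂ) ≠ 0 := Complex.two_pi_I_ne_zero
      have h2 : (((t : ℕ) : ℂ) - ((j : ℕ) : ℂ)) = n * N := by
        rw [div_eq_iff hN] at hn
        apply mul_left_cancel₀ hpi
        rw [hn]
        ring
      have h3 : ((t : ℕ) : ℤ) - ((j : ℕ) : ℤ) = n * N := by exact_mod_cast h2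
      have h4 : |((t : ℕ) : ℤ) - ((j : ℕ) : ℤ)| < N := by
        rw [abs_lt]
        have := t.2
        have := j.2
        omega
      have h5 := Int.eq_zero_of_abs_lt_dvd (Dvd.intro_left n h3.symm) h4
      exact h (Fin.ext (by omega))
    have hp : ζ ^ N = 1 := by
      rw [hζ, ← Complex.exp_nat_mul, Complex.exp_eq_one_iff]
      refine ⟨((t : ℕ) : ℤ) - ((j : ℕ) : ℤ), ?_⟩
      push_cast
      field_simp
    rw [geom_sum_eq h1, hp]
    simp

lemma norm_fourier1D (N : ℕ) (k j : Fin N) : ‖fourier1D N k j‖ = 1 / Real.sqrt N := by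
  rw [fourier1D, Matrix.of_apply, norm_mul, Complex.norm_real, Real.norm_of_nonneg (by positivity)]
  have : (-2 * Real.pi * Complex.I * ((k : ℕ) : ℂ) * ((j : ℕ) : ℂ) / (N : ℂ)) =
      ((-2 * Real.pi * (k : ℕ) * (j : ℕ) / N : ℝ) : ℂ) * Complex.I := by
    push_cast
    ring
  rw [this, Complex.norm_exp_ofReal_mul_I, mul_one]

lemma sum_star_fourier1D_mul_sum (N : ℕ) (y : Fin N → ℂ) (t : Fin N) :
    ∑ k, star (fourier1D N k t) * ∑ j, fourier1D N k j * y j = y t := by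
  simp only [Finset.mul_sum, ← mul_assoc]
  rw [Finset.sum_comm]
  simp only [← Finset.sum_mul, sum_star_fourier1D_mul]
  simp

lemma eq_zero_of_fourier1D_eq_zero (N : ℕ) (y : Fin N → ℂ)
    (h : ∀ k, ∑ j, fourier1D N k j * y j = 0) : y = 0 := by
  funext t
  rw [← sum_star_fourier1D_mul_sum N y t]
  simp [h]

lemma sum_norm_sq_fourier1D (N : ℕ) (y : Fin N → ℂ) :
    ∑ k, ‖∑ j, fourier1D N k j * y j‖ ^ 2 = ∑ j, ‖y j‖ ^ 2 := by
  have key : ∑ k, star (∑ j, fourier1D N k j * y j) * (∑ j, fourier1D N k j * y j) =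
      ∑ j, star (y j) * y j := by
    have h1 : ∀ k, star (∑ j, fourier1D N k j * y j) * (∑ j, fourier1D N k j * y j) =
        ∑ t, star (y t) * (star (fourier1D N k t) * ∑ j, fourier1D N k j * y j) := by
      intro k
      rw [star_sum, Finset.sum_mul]
      exact Finset.sum_congr rfl fun t _ => by rw [star_mul']; ring
    simp only [h1]
    rw [Finset.sum_comm]
    simp only [← Finset.mul_sum, sum_star_fourier1D_mul_sum]
  have h2 : ∀ z : ℂ, star z * z = ((‖z‖ ^ 2 : ℝ) : ℂ) := fun z => by
    rw [Complex.star_def, mul_comm, Complex.mul_conj, Complex.normSq_eq_norm_sq]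
  simp only [h2] at key
  exact_mod_cast key

/-! ### Bernstein inequalities for uniform samples, by counting -/

/-- Chernoff's argument with `exp y ≤ 1 + y + y ^ 2` for `|y| ≤ 1`. Counting samples replaces
independence: the sum of the exponentials over all samples is an `n`-th power. -/
lemma card_le_sum_sample_le {κ : Type*} [Fintype κ] (f : κ → ℝ) (n : ℕ)
    {B V a t : ℝ} (hB : ∀ k, |f k| ≤ B) (hf : ∑ k, f k = 0)
    (hV : ∑ k, f k ^ 2 ≤ V * Fintype.card κ) (ha : 0 ≤ a) (haB : a * B ≤ 1) :
    ((Finset.univ.filter fun c : Fin n → κ => n * t < ∑ l, f (c l)).card : ℝ) ≤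
      Real.exp (n * (a ^ 2 * V - a * t)) * (Fintype.card κ : ℝ) ^ n := by
  have h1 : ∑ k, Real.exp (a * f k) ≤ Fintype.card κ * Real.exp (a ^ 2 * V) := by
    have hk : ∀ k, Real.exp (a * f k) ≤ 1 + a * f k + a ^ 2 * f k ^ 2 := by
      intro k
      have : |a * f k| ≤ 1 := by
        rw [abs_mul, abs_of_nonneg ha]
        exact (mul_le_mul_of_nonneg_left (hB k) ha).trans haB
      have := (abs_le.1 (Real.abs_exp_sub_one_sub_id_le this)).2
      nlinarith
    calc ∑ k, Real.exp (a * f k) ≤ ∑ k, (1 + a * f k + a ^ 2 * f k ^ 2) :=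
          Finset.sum_le_sum fun k _ => hk k
      _ = Fintype.card κ + a ^ 2 * ∑ k, f k ^ 2 := by
          rw [Finset.sum_add_distrib, Finset.sum_add_distrib, ← Finset.mul_sum, ← Finset.mul_sum,
            hf]
          simp
      _ ≤ Fintype.card κ * (a ^ 2 * V + 1) := by
          nlinarith [mul_le_mul_of_nonneg_left hV (sq_nonneg a)]
      _ ≤ _ := by
          gcongr
          exact Real.add_one_le_exp _
  have h2 : ∑ c : Fin n → κ, Real.exp (a * ∑ l, f (c l)) = (∑ k, Real.exp (a * f k)) ^ n := by
    rw [Fintype.sum_pow]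
    exact Finset.sum_congr rfl fun c _ => by rw [Finset.mul_sum, Real.exp_sum]
  have h3 : ((Finset.univ.filter fun c : Fin n → κ => n * t < ∑ l, f (c l)).card : ℝ) *
      Real.exp (a * (n * t)) ≤ ∑ c : Fin n → κ, Real.exp (a * ∑ l, f (c l)) := by
    rw [← nsmul_eq_mul]
    refine (Finset.card_nsmul_le_sum _ (fun c => Real.exp (a * ∑ l, f (c l))) _ ?_).trans
      (Finset.sum_le_univ_sum_of_nonneg fun c => (Real.exp_pos _).le)
    intro c hc
    rw [Finset.mem_filter] at hc
    exact Real.exp_le_exp.2 (mul_le_mul_of_nonneg_left hc.2.le ha)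
  have h4 : (∑ k, Real.exp (a * f k)) ^ n ≤
      (Fintype.card κ * Real.exp (a ^ 2 * V)) ^ n :=
    pow_le_pow_left₀ (Finset.sum_nonneg fun k _ => (Real.exp_pos _).le) h1 n
  rw [h2] at h3
  have h5 := h3.trans h4
  rw [mul_pow, ← Real.exp_nat_mul] at h5
  rw [mul_sub, Real.exp_sub, div_mul_eq_mul_div, le_div_iff₀ (Real.exp_pos _)]
  calc _ = _ := by rw [show (n : ℝ) * (a * t) = a * (n * t) by ring]
    _ ≤ _ := h5
    _ = _ := by ring

lemma card_not_norm_sum_sample_le {κ : Type*} [Fintype κ] (f : κ → ℂ) (n : ℕ) {q r : ℝ}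
    (hq : 0 < q) (hr : 0 < r) (hB : ∀ k, ‖f k‖ ≤ 2 * q * r) (hf : ∑ k, f k = 0)
    (hV : ∑ k, ‖f k‖ ^ 2 ≤ 4 * q * r ^ 2 * Fintype.card κ) :
    ((Finset.univ.filter fun c : Fin n → κ => ¬ ‖∑ l, f (c l)‖ ≤ n * (r / 4)).card : ℝ) ≤
      4 * Real.exp (-(n / (1024 * q))) * (Fintype.card κ : ℝ) ^ n := by
  classical
  have main : ∀ g : κ → ℝ, (∀ k, |g k| ≤ ‖f k‖) → ∑ k, g k = 0 →
      ((Finset.univ.filter fun c : Fin n → κ => n * (r / 8) < ∑ l, g (c l)).card : ℝ) ≤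
        Real.exp (-(n / (1024 * q))) * (Fintype.card κ : ℝ) ^ n := by
    intro g hg hg0
    -- With `V = 4 * q * r ^ 2` and `t = r / 8`, this `a` is the minimizer `t / (2 * V)` of the
    -- exponent, whose value is `-1 / (1024 * q)`.
    have := card_le_sum_sample_le g n (a := 1 / (64 * q * r)) (t := r / 8)
      (fun k => (hg k).trans (hB k)) hg0
      ((Finset.sum_le_sum fun k _ => by
        rw [← sq_abs]; exact pow_le_pow_left₀ (abs_nonneg _) (hg k) 2).trans hV)
      (by positivity) (by field_simp; norm_num)
    convert this using 3
    field_simp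
    ring
  have hre := main (fun k => (f k).re) (fun k => Complex.abs_re_le_norm _)
    (by rw [← Complex.re_sum, hf, Complex.zero_re])
  have him := main (fun k => (f k).im) (fun k => Complex.abs_im_le_norm _)
    (by rw [← Complex.im_sum, hf, Complex.zero_im])
  have hre' := main (fun k => -(f k).re) (fun k => by rw [abs_neg]; exact Complex.abs_re_le_norm _)
    (by rw [Finset.sum_neg_distrib, ← Complex.re_sum, hf, Complex.zero_re, neg_zero])
  have him' := main (fun k => -(f k).im) (fun k => by rw [abs_neg]; exact Complex.abs_im_le_norm _)
    (by rw [Finset.sum_neg_distrib, ← Complex.im_sum, hf, Complex.zero_im, neg_zero])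
  set P : ((Fin n → κ) → ℝ) → Finset (Fin n → κ) := fun F =>
    Finset.univ.filter fun c => n * (r / 8) < F c with hP
  have hsub : (Finset.univ.filter fun c : Fin n → κ => ¬ ‖∑ l, f (c l)‖ ≤ n * (r / 4)) ⊆
      (P (fun c => ∑ l, (f (c l)).re) ∪ P (fun c => ∑ l, -(f (c l)).re)) ∪
        (P (fun c => ∑ l, (f (c l)).im) ∪ P (fun c => ∑ l, -(f (c l)).im)) := by
    intro c
    simp only [hP, Finset.mem_union, Finset.mem_filter, Finset.mem_univ, true_and,
      Finset.sum_neg_distrib, ← Complex.re_sum, ← Complex.im_sum]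
    intro hc
    by_contra! h
    obtain ⟨⟨h1, h2⟩, h3, h4⟩ := h
    have := Complex.norm_le_abs_re_add_abs_im (∑ l, f (c l))
    have h5 := abs_le.2 ⟨neg_le.1 h2, h1⟩
    have h6 := abs_le.2 ⟨neg_le.1 h4, h3⟩
    exact hc (by linarith)
  have hcard := (Finset.card_le_card hsub).trans ((Finset.card_union_le _ _).trans
    (add_le_add (Finset.card_union_le _ _) (Finset.card_union_le _ _)))
  have hcard' := (Nat.cast_le (α := ℝ)).2 hcard
  push_cast at hcard'
  linarith

/-! ### The golfing scheme -/

/-- `u` is orthogonal to all `h` in `Ker`, it is close to `w` on `S` and small outside `S`. -/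
def IsApproxCertificate {ι : Type*} [Fintype ι] (S : Finset ι) (Ker : Set (ι → ℂ))
    (w u : ι → ℂ) (η θ : ℝ) : Prop :=
  (∀ h ∈ Ker, ∑ a, star (u a) * h a = 0) ∧ (∀ a ∈ S, ‖u a - w a‖ ≤ η) ∧ ∀ a ∉ S, ‖u a‖ ≤ θ

/-- The certificate is the sum of the estimates `T` of successive residuals. The residual on `S`
shrinks by `4` per batch, and off `S` the estimates add up to at most `r / 4 + (r / 4) / 3 = r / 3`.
-/
lemma card_not_exists_certificate_le {ι α : Type*} [Fintype ι] [Fintype α] (S : Finset ι)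
    (T : α → (ι → ℂ) → ι → ℂ) (Ker : α → Set (ι → ℂ))
    (hT : ∀ c w, ∀ h ∈ Ker c, ∑ a, star (T c w a) * h a = 0) {p : ℝ}
    (hp : ∀ (r : ℝ) (w : ι → ℂ), 0 < r → (∀ a ∉ S, w a = 0) → (∀ a, ‖w a‖ ≤ r) →
      (Nat.card {c : α // ¬ ∀ a, ‖T c w a - w a‖ ≤ r / 4} : ℝ) ≤ p * Fintype.card α)
    (L : ℕ) : ∀ (r : ℝ) (w : ι → ℂ), 0 < r → (∀ a ∉ S, w a = 0) → (∀ a, ‖w a‖ ≤ r) →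
      (Nat.card {c : Fin L → α // ¬ ∃ u, IsApproxCertificate S {h | ∀ l, h ∈ Ker (c l)} w u
        (r / 4 ^ L) (r / 3)} : ℝ) ≤ L * p * (Fintype.card α : ℝ) ^ L := by
  classical
  induction L with
  | zero =>
    intro r w hr hw hwr
    have : IsEmpty {c : Fin 0 → α // ¬ ∃ u, IsApproxCertificate S {h | ∀ l, h ∈ Ker (c l)} w u
        (r / 4 ^ 0) (r / 3)} := by
      refine ⟨fun c => c.2 ⟨0, by simp, fun a _ => by simpa using hwr a, fun a _ => ?_⟩⟩
      simp only [Pi.zero_apply, norm_zero]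
      positivity
    rw [Nat.card_of_isEmpty]
    simp
  | succ L ih =>
    intro r w hr hw hwr
    -- The residual is cut down to `S`, since `hp` only covers targets supported there.
    set w' : α → ι → ℂ := fun c a => if a ∈ S then w a - T c w a else 0 with hw'
    set bad : α → Prop := fun c => ¬ ∀ a, ‖T c w a - w a‖ ≤ r / 4 with hbad
    set rest : α → (Fin L → α) → Prop := fun c C =>
      ¬ ∃ u, IsApproxCertificate S {h | ∀ l, h ∈ Ker (C l)} (w' c) u (r / 4 / 4 ^ L) (r / 4 / 3)
      with hrest
    have hstep : ∀ (c : α) (C : Fin L → α), ¬ bad c → ¬ rest c C →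
        ∃ u, IsApproxCertificate S {h | ∀ l, h ∈ Ker ((Fin.cons c C : Fin (L + 1) → α) l)} w u
          (r / 4 ^ (L + 1)) (r / 3) := by
      intro c C hb hr'
      simp only [hbad, not_not] at hb
      simp only [hrest, not_not] at hr'
      obtain ⟨u, hu1, hu2, hu3⟩ := hr'
      refine ⟨fun a => T c w a + u a, ?_, ?_, ?_⟩
      · intro h hh
        have h0 : h ∈ Ker c := hh 0
        have h1 : ∀ l, h ∈ Ker (C l) := fun l => by simpa using hh l.succ
        simp only [star_add, add_mul, Finset.sum_add_distrib, hT c w h h0, hu1 h h1, add_zero]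
      · intro a ha
        have := hu2 a ha
        simp only [hw', if_pos ha] at this
        rw [show T c w a + u a - w a = u a - (w a - T c w a) by ring]
        refine this.trans (le_of_eq ?_)
        rw [pow_succ]
        field_simp
      · intro a ha
        have h1 := hb a
        rw [hw a ha, sub_zero] at h1
        have := norm_add_le (T c w a) (u a)
        have := hu3 a ha
        linarith
    -- Once the first batch is fixed the residual is fixed, so the induction hypothesis applies on
    -- each fibre; this plays the role of independence of the batches.
    have hcount : (Finset.univ.filter fun c : Fin (L + 1) → α => ¬ ∃ u, IsApproxCertificate S
          {h | ∀ l, h ∈ Ker (c l)} w u (r / 4 ^ (L + 1)) (r / 3)).card ≤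
        (Finset.univ.filter fun x : α × (Fin L → α) => bad x.1).card +
        (Finset.univ.filter fun x : α × (Fin L → α) => ¬ bad x.1 ∧ rest x.1 x.2).card := by
      refine le_trans ?_ (Finset.card_union_le _ _)
      refine Finset.card_le_card_of_injOn (fun c => (c 0, Fin.tail c)) ?_ ?_
      · intro c hc
        simp only [Finset.coe_filter, Finset.mem_univ, true_and, Set.mem_ofPred_eq] at hc
        simp only [Finset.coe_union, Finset.coe_filter, Finset.mem_univ, true_and,
          Set.mem_union, Set.mem_ofPred_eq]
        by_cases hb : bad (c 0)
        · exact Or.inl hb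
        · refine Or.inr ⟨hb, ?_⟩
          simp only [hrest]
          by_contra hr'
          have := hstep (c 0) (Fin.tail c) hb (not_not.2 hr')
          rw [Fin.cons_self_tail] at this
          exact hc this
      · intro c _ d _ h
        rw [← Fin.cons_self_tail c, ← Fin.cons_self_tail d]
        simp only [Prod.mk.injEq] at h
        rw [h.1, h.2]
    have hA : ((Finset.univ.filter fun x : α × (Fin L → α) => bad x.1).card : ℝ) ≤
        p * (Fintype.card α : ℝ) ^ (L + 1) := by
      have h1 : (Finset.univ.filter fun x : α × (Fin L → α) => bad x.1) =
          (Finset.univ.filter bad) ×ˢ Finset.univ := by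
        ext x
        simp
      have h2 := hp r w hr hw hwr
      rw [Nat.card_eq_fintype_card, Fintype.card_subtype] at h2
      rw [h1, Finset.card_product, Finset.card_univ, Fintype.card_fun, Fintype.card_fin]
      push_cast
      calc _ ≤ p * Fintype.card α * (Fintype.card α : ℝ) ^ L := by gcongr
        _ = _ := by ring
    have hB : ((Finset.univ.filter fun x : α × (Fin L → α) => ¬ bad x.1 ∧ rest x.1 x.2).card : ℝ) ≤
        L * p * (Fintype.card α : ℝ) ^ (L + 1) := by
      have h1 : (Finset.univ.filter fun x : α × (Fin L → α) => ¬ bad x.1 ∧ rest x.1 x.2).card =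
          ∑ c : α, (Finset.univ.filter fun C : Fin L → α => ¬ bad c ∧ rest c C).card := by
        simp only [Finset.card_filter, Fintype.sum_prod_type]
      have h2 : ∀ c, ((Finset.univ.filter fun C : Fin L → α => ¬ bad c ∧ rest c C).card : ℝ) ≤
          L * p * (Fintype.card α : ℝ) ^ L := by
        intro c
        -- No sign of `p` is assumed; the bound is nonnegative because it dominates a cardinality.
        have hpos : 0 ≤ (L : ℝ) * p * (Fintype.card α : ℝ) ^ L := by
          refine le_trans ?_ (ih r w hr hw hwr)
          positivity
        by_cases hb : bad c
        · simpa [hb] using hpos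
        · have hb' : ∀ a, ‖T c w a - w a‖ ≤ r / 4 := not_not.1 hb
          have := ih (r / 4) (w' c) (by positivity) (fun a ha => by simp [hw', ha]) (fun a => by
            by_cases ha : a ∈ S
            · simp only [hw', if_pos ha]
              rw [norm_sub_rev]
              exact hb' a
            · simp only [hw', if_neg ha, norm_zero]
              positivity)
          rw [Nat.card_eq_fintype_card, Fintype.card_subtype] at this
          simpa only [hb, not_false_eq_true, true_and] using this
      rw [h1]
      push_cast
      refine (Finset.sum_le_sum fun c _ => h2 c).trans (le_of_eq ?_)
      rw [Finset.sum_const, Finset.card_univ, nsmul_eq_mul]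
      ring
    rw [Nat.card_eq_fintype_card, Fintype.card_subtype]
    have := (Nat.cast_le (α := ℝ)).2 hcount
    push_cast at this ⊢
    linarith

/-! ### Recovery from approximate dual certificates -/

/-- At `x = 0` the sign `x / ‖x‖` is `0` by convention, and the inequality remains true. -/
lemma le_norm_add_of_star_sign (x h : ℂ) :
    ‖x‖ + (star (x / ‖x‖) * h).re ≤ ‖x + h‖ := by
  by_cases hx : x = 0
  · simp [hx]
  have hx' : (‖x‖ : ℂ) ≠ 0 := by simpa using hx
  have h1 : star (x / ‖x‖) * x = ‖x‖ := by
    rw [Complex.star_def, map_div₀, Complex.conj_ofReal, div_mul_eq_mul_div, mul_comm,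
      Complex.mul_conj, Complex.normSq_eq_norm_sq]
    push_cast
    field_simp
  have h2 : ‖star (x / ‖x‖)‖ = 1 := by
    rw [norm_star, norm_div, Complex.norm_real, norm_norm, div_self (by simpa using hx)]
  calc ‖x‖ + (star (x / ‖x‖) * h).re = (star (x / ‖x‖) * (x + h)).re := by
        rw [mul_add, h1, Complex.add_re, Complex.ofReal_re]
    _ ≤ ‖star (x / ‖x‖) * (x + h)‖ := Complex.re_le_norm _
    _ = ‖x + h‖ := by rw [norm_mul, h2, one_mul]

lemma norm_sum_star_mul_le_of_certificate {ι : Type*} [Fintype ι] [DecidableEq ι] {S : Finset ι}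
    {Ker : Set (ι → ℂ)} {w u h : ι → ℂ} {η θ : ℝ} (hu : IsApproxCertificate S Ker w u η θ)
    (hh : h ∈ Ker) :
    ‖∑ a ∈ S, star (w a) * h a‖ ≤ η * ∑ a ∈ S, ‖h a‖ + θ * ∑ a ∈ Sᶜ, ‖h a‖ := by
  have h0 := hu.1 h hh
  rw [← Finset.sum_add_sum_compl S] at h0
  have h1 : ∑ a ∈ S, star (w a) * h a =
      -(∑ a ∈ S, star (u a - w a) * h a + ∑ a ∈ Sᶜ, star (u a) * h a) := by
    simp only [star_sub, sub_mul, Finset.sum_sub_distrib]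
    linear_combination h0
  rw [h1, norm_neg, Finset.mul_sum, Finset.mul_sum]
  refine (norm_add_le _ _).trans (add_le_add ?_ ?_)
  · refine (norm_sum_le _ _).trans (Finset.sum_le_sum fun a ha => ?_)
    rw [norm_mul, norm_star]
    exact mul_le_mul_of_nonneg_right (hu.2.1 a ha) (norm_nonneg _)
  · refine (norm_sum_le _ _).trans (Finset.sum_le_sum fun a ha => ?_)
    rw [norm_mul, norm_star]
    exact mul_le_mul_of_nonneg_right (hu.2.2 a (Finset.mem_compl.1 ha)) (norm_nonneg _)

/-- Moving from `x` to `x + h` gains `H` off `S` and loses at most `η * P + H / 3` on `S`, by the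
sign certificate. The basis certificates give `η * P ≤ H / 9`, so the net gain is at least `5 * H /
9`. -/
lemma l1Norm_lt_of_certificates {ι : Type*} [Fintype ι] [DecidableEq ι] (S : Finset ι)
    (Ker : Set (ι → ℂ)) (x h : ι → ℂ) {η : ℝ} (hη : 4 * S.card * η ≤ 1) (hη0 : 0 ≤ η)
    (hx : ∀ a, a ∉ S → x a = 0) (hh : h ∈ Ker) (h0 : h ≠ 0)
    (hsign : ∃ u, IsApproxCertificate S Ker (fun a => x a / ‖x a‖) u η (1 / 3))
    (hbasis : ∀ b ∈ S, ∃ u, IsApproxCertificate S Ker (Pi.single b 1) u η (1 / 3)) :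
    l1Norm x < l1Norm (x + h) := by
  set P := ∑ a ∈ S, ‖h a‖ with hP
  set H := ∑ a ∈ Sᶜ, ‖h a‖ with hH
  have hP0 : 0 ≤ P := Finset.sum_nonneg fun _ _ => norm_nonneg _
  have hH0 : 0 ≤ H := Finset.sum_nonneg fun _ _ => norm_nonneg _
  have hb : ∀ b ∈ S, ‖h b‖ ≤ η * P + 1 / 3 * H := by
    intro b hbS
    obtain ⟨u, hu⟩ := hbasis b hbS
    have := norm_sum_star_mul_le_of_certificate hu hh
    rwa [Finset.sum_eq_single_of_mem b hbS
      (fun a _ hab => by rw [Pi.single_eq_of_ne hab, star_zero, zero_mul]),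
      Pi.single_eq_same, star_one, one_mul] at this
  have hPH : P ≤ S.card * (η * P + 1 / 3 * H) := by
    rw [← nsmul_eq_mul]
    exact Finset.sum_le_card_nsmul _ _ _ hb
  -- As `S.card * η ≤ 1 / 4`, the term in `P` on the right of `hPH` is absorbed by the left side.
  have hPH' : 9 * P ≤ 4 * (S.card * H) := by
    nlinarith [mul_le_mul_of_nonneg_right hη hP0]
  have hηP : 9 * (η * P) ≤ H := by
    nlinarith [mul_le_mul_of_nonneg_left hPH' hη0, mul_le_mul_of_nonneg_right hη hH0]
  have hHpos : 0 < H := by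
    refine lt_of_le_of_ne hH0 fun hz => h0 ?_
    have hPz : P = 0 := by
      rw [← hz] at hPH'
      linarith
    funext a
    by_cases ha : a ∈ S
    · exact norm_eq_zero.1 ((Finset.sum_eq_zero_iff_of_nonneg fun _ _ => norm_nonneg _).1 hPz a ha)
    · exact norm_eq_zero.1 ((Finset.sum_eq_zero_iff_of_nonneg fun _ _ => norm_nonneg _).1 hz.symm a
        (Finset.mem_compl.2 ha))
  obtain ⟨v, hv⟩ := hsign
  have hv' := norm_sum_star_mul_le_of_certificate hv hh
  have hre := (abs_le.1 ((Complex.abs_re_le_norm _).trans hv')).1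
  rw [Complex.re_sum] at hre
  have e1 : l1Norm x = ∑ a ∈ S, ‖x a‖ := by
    rw [l1Norm, ← Finset.sum_add_sum_compl S,
      Finset.sum_eq_zero (s := Sᶜ) fun a ha => by rw [hx a (Finset.mem_compl.1 ha), norm_zero],
      add_zero]
  have e2 : l1Norm (x + h) = ∑ a ∈ S, ‖x a + h a‖ + H := by
    rw [l1Norm, ← Finset.sum_add_sum_compl S]
    congr 1
    exact Finset.sum_congr rfl fun a ha => by
      rw [Pi.add_apply, hx a (Finset.mem_compl.1 ha), zero_add]
  have e3 : ∑ a ∈ S, ‖x a‖ + ∑ a ∈ S, (star (x a / ‖x a‖) * h a).re ≤ ∑ a ∈ S, ‖x a + h a‖ := by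
    rw [← Finset.sum_add_distrib]
    exact Finset.sum_le_sum fun a _ => le_norm_add_of_star_sign _ _
  rw [e1, e2]
  linarith

/-! ### Sampling horizontal lines -/

/-- The operator `N • (B_k)ᴴ B_k`, for the block `B_k` of the `k`-th horizontal line. -/
noncomputable def lineGram (N : ℕ) (k : Fin N) (w : Fin N × Fin N → ℂ) (a : Fin N × Fin N) : ℂ :=
  N * (star (fourier1D N k a.1) * ∑ j, fourier1D N k j * w (j, a.2))

/-- The average of `lineGram` over a sample of lines. -/
noncomputable def sampleGram (N : ℕ) {n : ℕ} (c : Fin n → Fin N) (w : Fin N × Fin N → ℂ)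
    (a : Fin N × Fin N) : ℂ :=
  (∑ l, lineGram N (c l) w a) / n

/-- The images whose Fourier transform vanishes on the `k`-th horizontal line. -/
noncomputable def lineKer (N : ℕ) (k : Fin N) : Set (Fin N × Fin N → ℂ) :=
  {h | ∀ i, ∑ j, fourier1D N k j * h (j, i) = 0}

/-- The image of `lineGram` consists of combinations of rows of `B_k`, up to conjugation. -/
lemma sum_star_lineGram_mul (N : ℕ) (k : Fin N) (w h : Fin N × Fin N → ℂ)
    (hh : h ∈ lineKer N k) : ∑ a, star (lineGram N k w a) * h a = 0 := by
  rw [Fintype.sum_prod_type_right]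
  refine Finset.sum_eq_zero fun i _ => ?_
  have : ∀ t, star (lineGram N k w (t, i)) * h (t, i) =
      N * star (∑ j, fourier1D N k j * w (j, i)) * (fourier1D N k t * h (t, i)) := by
    intro t
    simp only [lineGram, star_mul', star_star, star_natCast]
    ring
  simp only [this]
  rw [← Finset.mul_sum, hh i, mul_zero]

lemma sum_star_sampleGram_mul (N : ℕ) {n : ℕ} (c : Fin n → Fin N) (w h : Fin N × Fin N → ℂ)
    (hh : h ∈ {h | ∀ l, h ∈ lineKer N (c l)}) : ∑ a, star (sampleGram N c w a) * h a = 0 := by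
  simp only [sampleGram, star_div₀, star_sum, div_mul_eq_mul_div, Finset.sum_mul]
  rw [← Finset.sum_div, Finset.sum_comm,
    Finset.sum_eq_zero fun l _ => sum_star_lineGram_mul N (c l) w h (hh l), zero_div]

lemma norm_column_le {N : ℕ} {J : Finset (Fin N)} {w : Fin N × Fin N → ℂ} {r : ℝ}
    (hw : ∀ a, a.1 ∉ J → w a = 0) (hwr : ∀ a, ‖w a‖ ≤ r) (k i : Fin N) :
    ‖∑ j, fourier1D N k j * w (j, i)‖ ≤ 1 / Real.sqrt N * (J.card * r) := by
  rw [← Finset.sum_subset (Finset.subset_univ J)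
    fun j _ hj => by rw [hw (j, i) hj, mul_zero]]
  refine (norm_sum_le _ _).trans ?_
  calc _ ≤ ∑ j ∈ J, 1 / Real.sqrt N * r := Finset.sum_le_sum fun j _ => by
        rw [norm_mul, norm_fourier1D]
        exact mul_le_mul_of_nonneg_left (hwr _) (by positivity)
    _ = _ := by
        rw [Finset.sum_const, nsmul_eq_mul]
        ring

lemma sum_norm_sq_column_le {N : ℕ} {J : Finset (Fin N)} {w : Fin N × Fin N → ℂ} {r : ℝ}
    (hw : ∀ a, a.1 ∉ J → w a = 0) (hwr : ∀ a, ‖w a‖ ≤ r) (i : Fin N) :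
    ∑ k, ‖∑ j, fourier1D N k j * w (j, i)‖ ^ 2 ≤ J.card * r ^ 2 := by
  rw [sum_norm_sq_fourier1D N fun j => w (j, i), ← Finset.sum_subset (Finset.subset_univ J)
    fun j _ hj => by rw [hw (j, i) hj, norm_zero, sq, mul_zero], ← nsmul_eq_mul]
  exact Finset.sum_le_card_nsmul _ _ _ fun j _ => pow_le_pow_left₀ (norm_nonneg _) (hwr _) 2

lemma norm_lineGram {N : ℕ} (k : Fin N) (w : Fin N × Fin N → ℂ) (a : Fin N × Fin N) :
    ‖lineGram N k w a‖ = Real.sqrt N * ‖∑ j, fourier1D N k j * w (j, a.2)‖ := by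
  have hN : 0 < (N : ℝ) := Nat.cast_pos.2 (Fin.pos k)
  have hs : Real.sqrt N ≠ 0 := (Real.sqrt_pos.2 hN).ne'
  rw [lineGram, norm_mul, norm_mul, norm_star, norm_fourier1D, Complex.norm_natCast, ← mul_assoc]
  congr 1
  field_simp
  exact (Real.sq_sqrt hN.le).symm

lemma card_not_norm_sampleGram_sub_le {N : ℕ} {J : Finset (Fin N)} {w : Fin N × Fin N → ℂ} {r : ℝ}
    {n : ℕ} (hn : 0 < n) (hJ : 1 ≤ J.card) (hr : 0 < r)
    (hw : ∀ a, a.1 ∉ J → w a = 0) (hwr : ∀ a, ‖w a‖ ≤ r) (a : Fin N × Fin N) :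
    ((Finset.univ.filter fun c : Fin n → Fin N =>
      ¬ ‖sampleGram N c w a - w a‖ ≤ r / 4).card : ℝ) ≤
      4 * Real.exp (-(n / (1024 * J.card))) * (N : ℝ) ^ n := by
  have hN : 0 < (N : ℝ) := Nat.cast_pos.2 (Fin.pos a.1)
  have hq : (1 : ℝ) ≤ J.card := by exact_mod_cast hJ
  have hn' : (0 : ℝ) < n := Nat.cast_pos.2 hn
  have hs : 0 < Real.sqrt N := Real.sqrt_pos.2 hN
  have key := card_not_norm_sum_sample_le (fun k => lineGram N k w a - w a) n
    (q := J.card) (by linarith) hr ?_ ?_ ?_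
  · rw [Fintype.card_fin] at key
    refine le_trans (le_of_eq ?_) key
    congr 3
    ext c
    rw [Finset.sum_sub_distrib, Finset.sum_const, Finset.card_univ, Fintype.card_fin, nsmul_eq_mul]
    have : sampleGram N c w a - w a = (∑ l, lineGram N (c l) w a - n * w a) / n := by
      rw [sampleGram, sub_div, mul_div_cancel_left₀ _ (Nat.cast_ne_zero.2 hn.ne')]
    rw [this, norm_div, Complex.norm_natCast, div_le_iff₀ hn', mul_comm (r / 4)]
  · intro k
    have h1 : ‖lineGram N k w a‖ ≤ J.card * r := by
      rw [norm_lineGram]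
      calc _ ≤ Real.sqrt N * (1 / Real.sqrt N * (J.card * r)) := by
            gcongr
            exact norm_column_le hw hwr k a.2
        _ = _ := by field_simp
    have h2 := norm_sub_le (lineGram N k w a) (w a)
    have h3 := hwr a
    nlinarith
  · rw [Finset.sum_sub_distrib]
    simp only [lineGram]
    rw [← Finset.mul_sum, sum_star_fourier1D_mul_sum N fun j => w (j, a.2)]
    simp
  -- Parseval on one column bounds the second moment by `2 * q * r ^ 2 + 2 * r ^ 2 ≤ 4 * q * r ^ 2`
  -- on average.
  · have h1 : ∀ k, ‖lineGram N k w a - w a‖ ^ 2 ≤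
        2 * N * ‖∑ j, fourier1D N k j * w (j, a.2)‖ ^ 2 + 2 * r ^ 2 := by
      intro k
      have h2 := norm_sub_le (lineGram N k w a) (w a)
      have h3 := hwr a
      have h4 : ‖lineGram N k w a‖ ^ 2 = N * ‖∑ j, fourier1D N k j * w (j, a.2)‖ ^ 2 := by
        rw [norm_lineGram, mul_pow, Real.sq_sqrt hN.le]
      calc _ ≤ (‖lineGram N k w a‖ + r) ^ 2 :=
            pow_le_pow_left₀ (norm_nonneg _) (h2.trans (by linarith)) 2
        _ ≤ 2 * ‖lineGram N k w a‖ ^ 2 + 2 * r ^ 2 := by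
            nlinarith [sq_nonneg (‖lineGram N k w a‖ - r)]
        _ = _ := by rw [h4]; ring
    refine (Finset.sum_le_sum fun k _ => h1 k).trans ?_
    rw [Finset.sum_add_distrib, ← Finset.mul_sum, Finset.sum_const, Finset.card_univ,
      Fintype.card_fin, nsmul_eq_mul]
    have h2 := sum_norm_sq_column_le hw hwr a.2
    have h3 : (N : ℝ) * r ^ 2 ≤ J.card * (N * r ^ 2) :=
      le_mul_of_one_le_left (by positivity) hq
    nlinarith [mul_le_mul_of_nonneg_left h2 hN.le]

lemma card_not_forall_norm_sampleGram_sub_le {N : ℕ} {J : Finset (Fin N)}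
    {w : Fin N × Fin N → ℂ} {r : ℝ} {n : ℕ} (hn : 0 < n) (hJ : 1 ≤ J.card) (hr : 0 < r)
    (hw : ∀ a, a.1 ∉ J → w a = 0) (hwr : ∀ a, ‖w a‖ ≤ r) :
    (Nat.card {c : Fin n → Fin N // ¬ ∀ a, ‖sampleGram N c w a - w a‖ ≤ r / 4} : ℝ) ≤
      4 * (N : ℝ) ^ 2 * Real.exp (-(n / (1024 * J.card))) *
        Fintype.card (Fin n → Fin N) := by
  classical
  rw [Nat.card_eq_fintype_card, Fintype.card_subtype]
  have h1 : (Finset.univ.filter fun c : Fin n → Fin N =>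
      ¬ ∀ a, ‖sampleGram N c w a - w a‖ ≤ r / 4) ⊆
      Finset.univ.biUnion fun a => Finset.univ.filter fun c : Fin n → Fin N =>
        ¬ ‖sampleGram N c w a - w a‖ ≤ r / 4 := by
    intro c
    simp
  have h2 := (Nat.cast_le (α := ℝ)).2 ((Finset.card_le_card h1).trans Finset.card_biUnion_le)
  push_cast at h2
  refine h2.trans ((Finset.sum_le_sum fun a _ =>
    card_not_norm_sampleGram_sub_le hn hJ hr hw hwr a).trans (le_of_eq ?_))
  rw [Finset.sum_const, Finset.card_univ, nsmul_eq_mul]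
  simp only [Fintype.card_prod, Fintype.card_fin, Fintype.card_fun]
  push_cast
  ring

/-- Injectivity of the transform along the line removes the second tensor factor. -/
lemma mem_lineKer_of_sensingMatrix_mulVec_eq_zero {N m : ℕ} (K : Fin m → Fin N)
    {h : Fin N × Fin N → ℂ}
    (hh : (sensingMatrix (horizontalLineBlock N) (uniformLines N) K).mulVec h = 0) (l : Fin m) :
    h ∈ lineKer N (K l) := by
  have hN : 0 < (N : ℝ) := Nat.cast_pos.2 (Fin.pos (K l))
  have hm : 0 < (m : ℝ) := Nat.cast_pos.2 (Fin.pos l)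
  set y : Fin N → ℂ := fun i => ∑ j, fourier1D N (K l) j * h (j, i) with hy
  suffices y = 0 from fun i => congrFun this i
  refine eq_zero_of_fourier1D_eq_zero N y fun k' => ?_
  have h1 := congrFun hh (l, k')
  set s : ℂ := ((1 / Real.sqrt m * (1 / Real.sqrt (1 / (N : ℝ))) : ℝ) : ℂ) with hs
  have hs0 : s ≠ 0 := Complex.ofReal_ne_zero.2 (by positivity)
  have h2 : (sensingMatrix (horizontalLineBlock N) (uniformLines N) K).mulVec h (l, k') =
      s * ∑ i, fourier1D N k' i * y i := by
    simp only [Matrix.mulVec, dotProduct, sensingMatrix, horizontalLineBlock, fourier2D,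
      uniformLines, Matrix.of_apply, Matrix.submatrix_apply, Matrix.kroneckerMap_apply, id]
    rw [Fintype.sum_prod_type_right, Finset.mul_sum]
    refine Finset.sum_congr rfl fun i _ => ?_
    rw [hy, Finset.mul_sum, Finset.mul_sum]
    exact Finset.sum_congr rfl fun j _ => by ring
  rw [h2, Pi.zero_apply] at h1
  exact (mul_eq_zero.1 h1).resolve_left hs0

/-! ### Probability -/

/-- Passage from counting to probability: each sample has mass `p ^ Fintype.card β`. -/
lemma measureReal_mem_finset_le_of_uniform {Ω β κ : Type*} [MeasurableSpace Ω] (μ : Measure Ω)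
    [IsProbabilityMeasure μ] [Fintype β] [MeasurableSpace κ]
    [MeasurableSingletonClass κ] (K : β → Ω → κ) (hK : iIndepFun K μ) {p : ℝ}
    (hp : ∀ l k, μ.real {ω | K l ω = k} = p) (T : Finset (β → κ)) :
    μ.real {ω | (fun b => K b ω) ∈ T} ≤ T.card * p ^ Fintype.card β := by
  have h1 : {ω | (fun b => K b ω) ∈ T} = ⋃ c ∈ T, ⋂ b, {ω | K b ω = c b} := by
    ext ω
    simp only [Set.mem_ofPred_eq, Set.mem_iUnion, Set.mem_iInter, exists_prop]
    constructor
    · exact fun h => ⟨_, h, fun b => rfl⟩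
    · rintro ⟨c, hc, h⟩
      rwa [show (fun b => K b ω) = c from funext h]
  have h2 : ∀ c : β → κ, μ.real (⋂ b, {ω | K b ω = c b}) = p ^ Fintype.card β := by
    intro c
    have := hK.meas_iInter (s := fun b => {ω | K b ω = c b})
      fun b => ⟨{c b}, MeasurableSet.singleton _, rfl⟩
    rw [measureReal_def, this, ENNReal.toReal_prod]
    simp only [← measureReal_def, hp]
    rw [Finset.prod_const, Finset.card_univ]
  rw [h1]
  refine (measureReal_biUnion_finset_le _ _).trans (le_of_eq ?_)
  simp only [h2]
  rw [Finset.sum_const, nsmul_eq_mul]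

lemma card_exists_not_certificate_le {N : ℕ} {J : Finset (Fin N)} {S : Finset (Fin N × Fin N)}
    (hSJ : ∀ a ∈ S, a.1 ∈ J) (hJ : 1 ≤ J.card) {n : ℕ} (hn : 0 < n) (L : ℕ)
    (F : Finset (Fin N × Fin N → ℂ)) (hF : ∀ w ∈ F, (∀ a ∉ S, w a = 0) ∧ ∀ a, ‖w a‖ ≤ 1) :
    (Nat.card {c : Fin L × Fin n → Fin N // ∃ w ∈ F, ¬ ∃ u,
      IsApproxCertificate S {h | ∀ b, h ∈ lineKer N (c b)} w u (1 / 4 ^ L) (1 / 3)} : ℝ) ≤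
      F.card * (L * (4 * (N : ℝ) ^ 2 * Real.exp (-(n / (1024 * J.card))))) *
        (N : ℝ) ^ (L * n) := by
  classical
  set bad : (Fin N × Fin N → ℂ) → (Fin L → Fin n → Fin N) → Prop := fun w c => ¬ ∃ u,
    IsApproxCertificate S {h | ∀ l, h ∈ {h | ∀ b, h ∈ lineKer N (c l b)}} w u
      (1 / 4 ^ L) (1 / 3) with hbad
  have h1 : Nat.card {c : Fin L × Fin n → Fin N // ∃ w ∈ F, ¬ ∃ u,
      IsApproxCertificate S {h | ∀ b, h ∈ lineKer N (c b)} w u (1 / 4 ^ L) (1 / 3)} =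
      (Finset.univ.filter fun c : Fin L → Fin n → Fin N => ∃ w ∈ F, bad w c).card := by
    rw [← Fintype.card_subtype, ← Nat.card_eq_fintype_card]
    refine Nat.card_congr (Equiv.subtypeEquiv (Equiv.curry _ _ _) fun c => ?_)
    simp only [hbad, Set.mem_ofPred_eq, Equiv.curry_apply, Function.curry, Prod.forall]
  have h2 : (Finset.univ.filter fun c : Fin L → Fin n → Fin N => ∃ w ∈ F, bad w c) ⊆
      F.biUnion fun w => Finset.univ.filter fun c => bad w c := by
    intro c
    simp
  have h3 := (Nat.cast_le (α := ℝ)).2 ((Finset.card_le_card h2).trans Finset.card_biUnion_le)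
  push_cast at h3
  rw [h1]
  refine h3.trans ((Finset.sum_le_card_nsmul _ _
    (L * (4 * (N : ℝ) ^ 2 * Real.exp (-(n / (1024 * J.card)))) * (N : ℝ) ^ (L * n))
    fun w hw => ?_).trans (le_of_eq ?_))
  · have := card_not_exists_certificate_le S (fun c : Fin n → Fin N => sampleGram N c)
      (fun c => {h | ∀ b, h ∈ lineKer N (c b)}) (fun c w h hh => sum_star_sampleGram_mul N c w h hh)
      (fun r w hr hw hwr => card_not_forall_norm_sampleGram_sub_le hn hJ hr
        (fun a ha => hw a fun haS => ha (hSJ a haS)) hwr) L 1 w one_pos (hF w hw).1 (hF w hw).2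
    rw [Nat.card_eq_fintype_card, Fintype.card_subtype] at this
    refine this.trans (le_of_eq ?_)
    simp only [Fintype.card_fun, Fintype.card_fin]
    push_cast
    rw [← pow_mul, mul_comm n L]
  · rw [nsmul_eq_mul]
    ring

lemma isUniqueL1Minimizer_of_certificates {N m : ℕ} (K : Fin m → Fin N)
    (S : Finset (Fin N × Fin N)) (x : Fin N × Fin N → ℂ) {β : Type*} (e : β → Fin m) {η : ℝ}
    (hη : 4 * S.card * η ≤ 1) (hη0 : 0 ≤ η) (hx : ∀ a, a ∉ S → x a = 0)
    (hcert : ∀ w ∈ insert (fun a => x a / ‖x a‖) (S.image fun b => Pi.single b (1 : ℂ)),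
      ∃ u, IsApproxCertificate S {h | ∀ b, h ∈ lineKer N (K (e b))} w u η (1 / 3)) :
    IsUniqueL1Minimizer (sensingMatrix (horizontalLineBlock N) (uniformLines N) K)
      ((sensingMatrix (horizontalLineBlock N) (uniformLines N) K).mulVec x) x := by
  refine ⟨rfl, fun z hz hzx => ?_⟩
  have hker : (sensingMatrix (horizontalLineBlock N) (uniformLines N) K).mulVec (z - x) = 0 := by
    rw [Matrix.mulVec_sub, hz, sub_self]
  have := l1Norm_lt_of_certificates S {h | ∀ b, h ∈ lineKer N (K (e b))} x (z - x) hη hη0 hx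
    (fun b => mem_lineKer_of_sensingMatrix_mulVec_eq_zero K hker (e b)) (sub_ne_zero.2 hzx)
    (hcert _ (Finset.mem_insert_self _ _))
    (fun b hb => hcert _ (Finset.mem_insert_of_mem (Finset.mem_image_of_mem _ hb)))
  rwa [add_sub_cancel] at this

lemma one_sub_le_measureReal_isUniqueL1Minimizer {N m : ℕ} {J : Finset (Fin N)}
    {S : Finset (Fin N × Fin N)} (x : Fin N × Fin N → ℂ) (hSJ : ∀ a ∈ S, a.1 ∈ J)
    (hJ : 1 ≤ J.card) (hx : ∀ a, a ∉ S → x a = 0) {n L : ℕ} (hn : 0 < n)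
    (hSL : 4 * S.card ≤ 4 ^ L) (hm : L * n ≤ m)
    {Ω : Type*} [MeasurableSpace Ω] (μ : Measure Ω) [IsProbabilityMeasure μ]
    (K : Fin m → Ω → Fin N) (hK : iIndepFun K μ)
    (hu : ∀ l k, μ.real {ω | K l ω = k} = uniformLines N k) :
    1 - (S.card + 1) * (L * (4 * (N : ℝ) ^ 2 * Real.exp (-(n / (1024 * J.card))))) ≤
      μ.real {ω | IsUniqueL1Minimizer
        (sensingMatrix (horizontalLineBlock N) (uniformLines N) (fun l => K l ω))
        ((sensingMatrix (horizontalLineBlock N) (uniformLines N)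
          (fun l => K l ω)).mulVec x) x} := by
  classical
  obtain ⟨j0, -⟩ := Finset.card_pos.1 hJ
  have hN : (N : ℝ) ≠ 0 := Nat.cast_ne_zero.2 (Fin.pos j0).ne'
  -- The first `L * n` draws form `L` batches of `n`; the others only add constraints and are
  -- ignored.
  set e : Fin L × Fin n → Fin m := fun b => Fin.castLE hm (finProdFinEquiv b) with he
  have he' : e.Injective := fun a b h => finProdFinEquiv.injective (Fin.castLE_injective hm h)
  set F : Finset (Fin N × Fin N → ℂ) :=
    insert (fun a => x a / ‖x a‖) (S.image fun b => Pi.single b (1 : ℂ)) with hF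
  have hFcard : (F.card : ℝ) ≤ S.card + 1 := by
    exact_mod_cast (Finset.card_insert_le _ _).trans (Nat.succ_le_succ Finset.card_image_le)
  have hF' : ∀ w ∈ F, (∀ a ∉ S, w a = 0) ∧ ∀ a, ‖w a‖ ≤ 1 := by
    intro w hw
    rcases Finset.mem_insert.1 hw with rfl | hw
    · refine ⟨fun a ha => by simp [hx a ha], fun a => ?_⟩
      rw [norm_div, Complex.norm_real, norm_norm]
      exact div_self_le_one _
    · obtain ⟨b, hb, rfl⟩ := Finset.mem_image.1 hw
      refine ⟨fun a ha => Pi.single_eq_of_ne (by rintro rfl; exact ha hb) _, fun a => ?_⟩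
      rw [Pi.single_apply]
      split_ifs <;> simp
  set T : Finset (Fin L × Fin n → Fin N) := Finset.univ.filter fun c => ∃ w ∈ F, ¬ ∃ u,
    IsApproxCertificate S {h | ∀ b, h ∈ lineKer N (c b)} w u (1 / 4 ^ L) (1 / 3) with hT
  have hTcard := card_exists_not_certificate_le hSJ hJ hn L F hF'
  rw [Nat.card_eq_fintype_card, Fintype.card_subtype] at hTcard
  have hbad := measureReal_mem_finset_le_of_uniform μ (fun b => K (e b)) (hK.precomp he')
    (p := 1 / (N : ℝ)) (fun l k => hu (e l) k) T
  set G : Set Ω := {ω | IsUniqueL1Minimizer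
        (sensingMatrix (horizontalLineBlock N) (uniformLines N) (fun l => K l ω))
        ((sensingMatrix (horizontalLineBlock N) (uniformLines N)
          (fun l => K l ω)).mulVec x) x} with hG
  have hSL' : (4 * S.card : ℝ) ≤ 4 ^ L := by exact_mod_cast hSL
  -- Covering and subadditivity avoid any measurability of the recovery event `G`.
  have hcover : Set.univ ⊆ G ∪ {ω | (fun b => K (e b) ω) ∈ T} := by
    intro ω _
    by_cases hω : (fun b => K (e b) ω) ∈ T
    · exact Or.inr hω
    · refine Or.inl (isUniqueL1Minimizer_of_certificates (fun l => K l ω) S x e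
        (η := 1 / 4 ^ L) ?_ (by positivity) hx ?_)
      · rw [mul_one_div]
        exact div_le_one_of_le₀ hSL' (by positivity)
      · rw [hT, Finset.mem_filter] at hω
        push Not at hω
        exact hω (Finset.mem_univ _)
  have h1 : 1 ≤ μ.real G + μ.real {ω | (fun b => K (e b) ω) ∈ T} := by
    rw [← probReal_univ (μ := μ)]
    exact (measureReal_mono hcover).trans (measureReal_union_le _ _)
  have h2 : μ.real {ω | (fun b => K (e b) ω) ∈ T} ≤
      (S.card + 1) * (L * (4 * (N : ℝ) ^ 2 * Real.exp (-(n / (1024 * J.card))))) := by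
    refine hbad.trans ((mul_le_mul_of_nonneg_right hTcard (by positivity)).trans ?_)
    rw [Fintype.card_prod, Fintype.card_fin, Fintype.card_fin, one_div, inv_pow, mul_assoc,
      mul_inv_cancel₀ (pow_ne_zero _ hN), mul_one]
    gcongr
  linarith

/-! ### Choice of the parameters -/

/-- Each of `N ^ 2`, `s` and `L` is at most `X`, so `exp (-t) ≤ X ^ (-8)` beats the polynomial
prefactors with room to spare. -/
lemma union_bound_le {X N s L ε t : ℝ} (hN : 2 ≤ N) (hs0 : 2 ≤ s) (hs : s ≤ N ^ 2) (hL : L ≤ s)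
    (hL0 : 0 ≤ L) (hε : 0 < ε) (hε1 : ε < 1) (hX : X = N ^ 2 / ε) (ht : 8 * Real.log X ≤ t) :
    (s + 1) * (L * (4 * N ^ 2 * Real.exp (-t))) ≤ ε := by
  have hNX : N ^ 2 ≤ X := by
    rw [hX]
    exact le_div_self (by positivity) hε hε1.le
  have hX4 : 4 ≤ X := by nlinarith
  have hX0 : 0 < X := by linarith
  have hexp : Real.exp (-t) ≤ 1 / X ^ 8 := by
    calc Real.exp (-t) ≤ Real.exp (-(8 * Real.log X)) := Real.exp_le_exp.2 (by linarith)
      _ = 1 / X ^ 8 := by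
        rw [Real.exp_neg, one_div, show (8 : ℝ) * Real.log X = (8 : ℕ) * Real.log X by norm_num,
          Real.exp_nat_mul, Real.exp_log hX0]
  have h8 : 8 ≤ X ^ 2 := by nlinarith
  calc (s + 1) * (L * (4 * N ^ 2 * Real.exp (-t)))
      ≤ (2 * X) * (X * (4 * X * (1 / X ^ 8))) := by gcongr <;> linarith
    _ = 8 / X ^ 5 := by field_simp; norm_num
    _ ≤ X ^ 2 / X ^ 5 := by gcongr
    _ = 1 / X ^ 3 := by field_simp
    _ ≤ 1 / X := by
        gcongr
        exact le_self_pow₀ (by linarith) (by norm_num)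
    _ = ε / N ^ 2 := by rw [hX, one_div_div]
    _ ≤ ε := div_le_self hε.le (by nlinarith)

theorem mainTheorem4 :
    ∃ C : ℝ, 0 < C ∧
      ∀ (N q s m : ℕ) (J : Finset (Fin N)) (S : Finset (Fin N × Fin N))
        (x : Fin N × Fin N → ℂ) (ε : ℝ),
        J.card = q →
        (∀ a ∈ S, a.1 ∈ J) →
        S.card = s →
        2 ≤ s →
        (∀ a, a ∉ S → x a = 0) →
        0 < ε → ε < 1 →
        C * (q : ℝ) * Real.log (s : ℝ) * Real.log ((N : ℝ) ^ 2 / ε) ≤ (m : ℝ) →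
        ∀ {Ω : Type*} [MeasurableSpace Ω] (μ : Measure Ω) [IsProbabilityMeasure μ]
          (K : Fin m → Ω → Fin N),
          (∀ l, Measurable (K l)) →
          iIndepFun K μ →
          (∀ l k, μ.real {ω | K l ω = k} = uniformLines N k) →
          1 - ε ≤ μ.real {ω |
            IsUniqueL1Minimizer
              (sensingMatrix (horizontalLineBlock N) (uniformLines N) (fun l => K l ω))
              ((sensingMatrix (horizontalLineBlock N) (uniformLines N)
                (fun l => K l ω)).mulVec x) x} := by
  -- `49152 = 3 * 2 * 8 * 1024`: `3` from `L ≤ 3 * log s`, `2` from rounding `m / L` down, `8` from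
  -- `union_bound_le`, `1024` from the Bernstein exponent.
  refine ⟨49152, by norm_num, ?_⟩
  intro N q s m J S x ε hJ hSJ hS hs hx hε hε1 hm Ω _ μ _ K _ hK hu
  subst hJ hS
  obtain ⟨a, ha⟩ := Finset.card_pos.1 (by omega : 0 < S.card)
  have hJ : 1 ≤ J.card := Finset.card_pos.2 ⟨a.1, hSJ a ha⟩
  have hSN : S.card ≤ N ^ 2 := by
    refine (Finset.card_le_univ S).trans (le_of_eq ?_)
    rw [Fintype.card_prod, Fintype.card_fin, sq]
  have hN : 2 ≤ N := by
    by_contra! h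
    have : N ^ 2 ≤ 1 := by interval_cases N <;> norm_num
    omega
  have hNr : (2 : ℝ) ≤ N := by exact_mod_cast hN
  have hsr : (2 : ℝ) ≤ S.card := by exact_mod_cast hs
  have hqr : (1 : ℝ) ≤ J.card := by exact_mod_cast hJ
  set X := (N : ℝ) ^ 2 / ε with hX
  -- Then `2 ^ L ≥ s + 1`, hence `4 ^ L ≥ (s + 1) ^ 2 ≥ 4 * s`, as the certificates require.
  set L := Nat.log 2 S.card + 1 with hLdef
  have hX4 : 4 ≤ X := by
    rw [hX, le_div_iff₀ hε]
    nlinarith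
  have hlogX : 1 ≤ Real.log X := by
    rw [Real.le_log_iff_exp_le (by linarith)]
    linarith [Real.exp_one_lt_three]
  have hL3 : (L : ℝ) ≤ 3 * Real.log S.card := by
    have h1 : (Nat.log 2 S.card : ℝ) * Real.log 2 ≤ Real.log S.card := by
      rw [← Real.log_pow]
      refine Real.log_le_log (by positivity) ?_
      exact_mod_cast Nat.pow_log_le_self 2 (by omega)
    have h2 : Real.log 2 ≤ Real.log S.card := Real.log_le_log (by norm_num) hsr
    have h3 := Real.log_two_gt_d9
    rw [hLdef]
    push_cast
    have h4 : (0 : ℝ) ≤ Nat.log 2 S.card := Nat.cast_nonneg _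
    nlinarith
  have hL0 : (0 : ℝ) < L := by exact_mod_cast Nat.succ_pos _
  have hLs : L ≤ S.card := Nat.log_lt_self 2 (by omega)
  have hSL : 4 * S.card ≤ 4 ^ L := by
    have h1 : S.card + 1 ≤ 2 ^ L := Nat.lt_pow_succ_log_self (by norm_num) _
    have h2 : (4 : ℕ) ^ L = 2 ^ L * 2 ^ L := by rw [← mul_pow]; norm_num
    rw [h2]
    nlinarith [Nat.mul_le_mul h1 h1, mul_self_nonneg ((S.card : ℤ) - 1), hs]
  have hmL : 16384 * (J.card * Real.log X) * L ≤ m := by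
    refine le_trans ?_ hm
    have : 0 ≤ J.card * Real.log X := by positivity
    nlinarith [mul_le_mul_of_nonneg_left hL3 this]
  have hqX : 1 ≤ J.card * Real.log X := one_le_mul_of_one_le_of_one_le hqr hlogX
  -- The floor loses less than `1`, which half of the lower bound `16384 * (J.card * Real.log X)`
  -- absorbs thanks to `hqX`.
  have hn : 8192 * (J.card * Real.log X) ≤ (m / L : ℕ) := by
    have h1 : (m : ℝ) / L < (m / L : ℕ) + 1 := by
      rw [div_lt_iff₀ hL0]
      exact_mod_cast Nat.lt_mul_of_div_lt (Nat.lt_succ_self _) (Nat.succ_pos _)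
    have h2 := (le_div_iff₀ hL0).2 hmL
    linarith
  have hn0 : 0 < m / L := by
    have : (0 : ℝ) < (m / L : ℕ) := by linarith
    exact_mod_cast this
  refine le_trans ?_ (one_sub_le_measureReal_isUniqueL1Minimizer x hSJ hJ hx hn0
    hSL (Nat.mul_div_le m L) μ K hK hu)
  have := union_bound_le (L := L) hNr hsr (by exact_mod_cast hSN) (by exact_mod_cast hLs) hL0.le
    hε hε1 hX (t := (m / L : ℕ) / (1024 * J.card)) (by
      rw [le_div_iff₀ (by positivity)]
      linarith)
  linarith
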